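/- Let $d \ge 1$ be an integer and let $z^dA(\mathbb D)$ be the set of all functions $f$ in the disc algebra $A(\mathbb D)$ (continuous on the closed unit disc, holomorphic in its interior) such that $f(0)=f'(0)=\cdots=f^{(d-1)}(0)=0$. For an operator (bounded linear operator) $T$ on a complex Hilbert space $H$ and an $n\times n$ matrix of polynomials $p_{ij}\in\mathbb C[z]$, the matrix $[p_{ij}(T)]_{1\le i,j\le n}$ is regarded as an operator on the Hilbert direct sum of $n$ copies of $H$, with its operator norm. An operator $T_1$ is called completely polynomially dominated by an operator $T_2$ (possibly on another Hilbert space) if $\|[p_{ij}(T_1)]\|\le\|[p_{ij}(T_2)]\|$ for all $n\ge1$ and all $n\times n$ matrices $[p_{ij}]$ of polynomials. Operators $T,T'$ on $H$ are similar if $T'=L^{-1}TL$ for some bounded operator $L$ on $H$ with bounded inverse. Let $S$ be the unilateral forward shift on $\ell_2$, $S(x_0,x_1,\dots)=(0,x_0,x_1,\dots)$. Let $T$ be an operator on a complex Hilbert space $H$ and let $M$ be a real number. (1) Let $C$ be an operator on a complex Hilbert space $H_c$ such that $$\big\|[p_{ij}(T)]_{1\le i,j\le n}\big\|\le M\,\big\|[p_{ij}(C)]_{1\le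 i,j\le n}\big\|$$ for all positive integers $n$ and all $n\times n$ matrices of polynomials $p_{ij}$ in $z^dA(\mathbb D)$. Then $T$ is similar to an operator on $H$ that is completely polynomially dominated by $C\oplus S$, acting on the Hilbert direct sum $H_c\oplus\ell_2$. (2) If $$\big\|[p_{ij}(T)]_{1\le i,j\le n}\big\|\le M\,\sup_{|z|=1}\big\|[p_{ij}(z)]_{1\le i,j\le n}\big\|$$ for all positive integers $n$ and all $n\times n$ matrices of polynomials $p_{ij}$ in $z^dA(\mathbb D)$, where $\|[p_{ij}(z)]\|$ is the operator norm of the scalar matrix on Euclidean $\mathbb C^n$, then $T$ is similar to a contraction, that is, to an operator $T'$ on $H$ with $\|T'\|\le1$. -/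

import Mathlib

open Polynomial

noncomputable section

namespace PolyDom

/-- The operator `[A i j]` on the Hilbert direct sum of `n` copies of `H`, that is
`(x_j)_j ↦ (∑ j, A i j x_j)_i`. -/
def opMatrix {H : Type*} [NormedAddCommGroup H] [InnerProductSpace ℂ H] {n : ℕ}
    (A : Fin n → Fin n → (H →L[ℂ] H)) :
    PiLp 2 (fun _ : Fin n => H) →L[ℂ] PiLp 2 (fun _ : Fin n => H) :=
  ((PiLp.continuousLinearEquiv 2 ℂ (fun _ : Fin n => H)).symm :
      (Fin n → H) →L[ℂ] PiLp 2 (fun _ : Fin n => H)) ∘L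
    (ContinuousLinearMap.pi fun i =>
      ∑ j, (A i j) ∘L (ContinuousLinearMap.proj (R := ℂ) (φ := fun _ : Fin n => H) j)) ∘L
    (PiLp.continuousLinearEquiv 2 ℂ (fun _ : Fin n => H) :
      PiLp 2 (fun _ : Fin n => H) →L[ℂ] (Fin n → H))

theorem opMatrix_apply {H : Type*} [NormedAddCommGroup H] [InnerProductSpace ℂ H] {n : ℕ}
    (A : Fin n → Fin n → (H →L[ℂ] H)) (x : PiLp 2 (fun _ : Fin n => H)) (i : Fin n) :
    opMatrix A x i = ∑ j, A i j (x j) := by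
  simp [opMatrix]

/-- The matrix `[p i j (T)]` of operators, acting on the direct sum of `n` copies of `H`. -/
def polyMatrix {H : Type*} [NormedAddCommGroup H] [InnerProductSpace ℂ H] {n : ℕ}
    (p : Fin n → Fin n → ℂ[X]) (T : H →L[ℂ] H) :
    PiLp 2 (fun _ : Fin n => H) →L[ℂ] PiLp 2 (fun _ : Fin n => H) :=
  opMatrix fun i j => aeval T (p i j)

/-- `‖[p i j (T₁)]‖ ≤ M ‖[p i j (T₂)]‖` for all square matrices of polynomials from `P`. -/
def DominatedOnWithBound {H₁ H₂ : Type*}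
    [NormedAddCommGroup H₁] [InnerProductSpace ℂ H₁]
    [NormedAddCommGroup H₂] [InnerProductSpace ℂ H₂]
    (P : Set ℂ[X]) (M : ℝ) (T₁ : H₁ →L[ℂ] H₁) (T₂ : H₂ →L[ℂ] H₂) : Prop :=
  ∀ n : ℕ, 0 < n → ∀ p : Fin n → Fin n → ℂ[X], (∀ i j, p i j ∈ P) →
    ‖polyMatrix p T₁‖ ≤ M * ‖polyMatrix p T₂‖

/-- `T₁` is completely polynomially dominated by `T₂`. -/
def CompletelyPolynomiallyDominated {H₁ H₂ : Type*}
    [NormedAddCommGroup H₁] [InnerProductSpace ℂ H₁]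
    [NormedAddCommGroup H₂] [InnerProductSpace ℂ H₂]
    (T₁ : H₁ →L[ℂ] H₁) (T₂ : H₂ →L[ℂ] H₂) : Prop :=
  ∀ n : ℕ, 0 < n → ∀ p : Fin n → Fin n → ℂ[X],
    ‖polyMatrix p T₁‖ ≤ ‖polyMatrix p T₂‖

/-- `T₂ = L⁻¹ T₁ L` for some bounded operator `L` on `H` with bounded inverse. -/
def Similar {H : Type*} [NormedAddCommGroup H] [InnerProductSpace ℂ H]
    (T₁ T₂ : H →L[ℂ] H) : Prop :=
  ∃ L : (H →L[ℂ] H)ˣ, T₂ = (↑L⁻¹ : H →L[ℂ] H) * T₁ * (↑L : H →L[ℂ] H)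

/-- The disc algebra `A(𝔻)`: functions continuous on the closed unit disc and holomorphic in the
open disc. They are represented by functions on `ℂ` whose values off the closed disc play no
role. -/
def diskAlgebra : Set (ℂ → ℂ) :=
  {f | ContinuousOn f (Metric.closedBall 0 1) ∧ DifferentiableOn ℂ f (Metric.ball 0 1)}

/-- `z^d A(𝔻)`: the functions in `A(𝔻)` with `f(0) = f'(0) = ⋯ = f^{(d-1)}(0) = 0`. -/
def zPowDiskAlgebra (d : ℕ) : Set (ℂ → ℂ) :=
  {f | f ∈ diskAlgebra ∧ ∀ k < d, iteratedDeriv k f 0 = 0}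

/-- The polynomials in `z^d A(𝔻)`. -/
def zPowPolynomials (d : ℕ) : Set ℂ[X] :=
  {p | (fun z : ℂ => p.eval z) ∈ zPowDiskAlgebra d}

/-- The Hilbert space `ℓ₂`, with orthonormal basis indexed by `0, 1, 2, …`. -/
abbrev ellTwo : Type := lp (fun _ : ℕ => ℂ) 2

/-- The sequence `(0, x₀, x₁, …)`. -/
def shiftSeq (x : ℕ → ℂ) : ℕ → ℂ
  | 0 => 0
  | k + 1 => x k

theorem hasSum_shiftSeq (x : ellTwo) :
    HasSum (fun k => ‖shiftSeq x k‖ ^ (2 : ENNReal).toReal) (‖x‖ ^ (2 : ENNReal).toReal) := by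
  rw [← hasSum_nat_add_iff' 1]
  simpa [shiftSeq] using lp.hasSum_norm (p := 2) (by norm_num) x

/-- The unilateral forward shift on `ℓ₂`, as a linear isometry. -/
def shiftIsometry : ellTwo →ₗᵢ[ℂ] ellTwo where
  toFun x := ⟨shiftSeq x, memℓp_gen (hasSum_shiftSeq x).summable⟩
  map_add' x y := by
    ext k
    cases k with
    | zero => exact (add_zero (0 : ℂ)).symm
    | succ k => rfl
  map_smul' c x := by
    ext k
    cases k <;> simp [shiftSeq]
  norm_map' x := by
    have h := (lp.hasSum_norm (p := 2) (by norm_num)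
      (⟨shiftSeq x, memℓp_gen (hasSum_shiftSeq x).summable⟩ : ellTwo)).unique (hasSum_shiftSeq x)
    exact (Real.rpow_left_inj (norm_nonneg _) (norm_nonneg _) (by norm_num)).1 h

/-- The unilateral forward shift `S (x₀, x₁, …) = (0, x₀, x₁, …)` as a bounded operator. -/
def shift : ellTwo →L[ℂ] ellTwo := shiftIsometry.toContinuousLinearMap

theorem shift_apply_zero (x : ellTwo) : shift x 0 = 0 := rfl

theorem shift_apply_succ (x : ellTwo) (k : ℕ) : shift x (k + 1) = x k := rfl

/-- The operator `A ⊕ B` on the Hilbert direct sum `E ⊕ F`. -/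
def directSum {E F : Type*} [NormedAddCommGroup E] [InnerProductSpace ℂ E]
    [NormedAddCommGroup F] [InnerProductSpace ℂ F] (A : E →L[ℂ] E) (B : F →L[ℂ] F) :
    WithLp 2 (E × F) →L[ℂ] WithLp 2 (E × F) :=
  ((WithLp.prodContinuousLinearEquiv 2 ℂ E F).symm : (E × F) →L[ℂ] WithLp 2 (E × F)) ∘L
    (A.prodMap B) ∘L
    (WithLp.prodContinuousLinearEquiv 2 ℂ E F : WithLp 2 (E × F) →L[ℂ] (E × F))

theorem directSum_apply {E F : Type*} [NormedAddCommGroup E] [InnerProductSpace ℂ E]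
    [NormedAddCommGroup F] [InnerProductSpace ℂ F] (A : E →L[ℂ] E) (B : F →L[ℂ] F)
    (x : E) (y : F) :
    directSum A B (WithLp.toLp 2 (x, y)) = WithLp.toLp 2 (A x, B y) := rfl

/-- `‖[p i j (z)]‖`, the norm of a scalar matrix as an operator on Euclidean `ℂⁿ`. -/
def scalarNorm {n : ℕ} (p : Fin n → Fin n → ℂ[X]) (z : ℂ) : ℝ :=
  ‖Matrix.toEuclideanCLM (n := Fin n) (𝕜 := ℂ) (Matrix.of fun i j => (p i j).eval z)‖

/-- `sup_{|z| = 1} ‖[p i j (z)]‖`. -/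
def circleSup {n : ℕ} (p : Fin n → Fin n → ℂ[X]) : ℝ :=
  ⨆ z : Metric.sphere (0 : ℂ) 1, scalarNorm p z

/-- The supremum defining `circleSup` is that of a bounded family. -/
theorem bddAbove_scalarNorm {n : ℕ} (p : Fin n → Fin n → ℂ[X]) :
    BddAbove (Set.range fun z : Metric.sphere (0 : ℂ) 1 => scalarNorm p z) := by
  have hc : Continuous fun z : ℂ =>
      (Matrix.of fun i j => (p i j).eval z : Matrix (Fin n) (Fin n) ℂ) :=
    continuous_matrix fun i j => (p i j).continuous
  have hl : Continuous (Matrix.toEuclideanCLM (n := Fin n) (𝕜 := ℂ)) :=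
    LinearMap.continuous_of_finiteDimensional
      ((Matrix.toEuclideanCLM (n := Fin n) (𝕜 := ℂ)).toAlgEquiv.toLinearMap)
  have h : Continuous fun z : Metric.sphere (0 : ℂ) 1 => scalarNorm p z :=
    (hl.comp (hc.comp continuous_subtype_val)).norm
  exact (isCompact_range h).bddAbove

end PolyDom

end

/-!
The heart of the matter is a form of Paulsen's similarity theorem (`exists_similar_of_dominated`):
if `‖[p_ij(T)]‖ ≤ K ‖[p_ij(B)]‖` for all matrices of polynomials, then `T` is similar to an operator
completely polynomially dominated by `B`. The reduction to it is elementary. A matrix `p` of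
polynomials is split into its Taylor polynomial of degree less than `d` and a remainder in
`z^d A(𝔻)`. The coefficient matrices are bounded by `‖p(S)‖`, and the remainder is controlled by the
hypothesis, so `T` is dominated by `C ⊕ S` with some constant
(`exists_dominated_directSum_shift`). For the second assertion one takes `C = S`: the supremum over
the circle is at most `‖p(S)‖`, as the vectors `(conj w ^ k)_k` are eigenvectors of the adjoint of
`S`, and an operator dominated by the contraction `S ⊕ S` is a contraction.

Paulsen's theorem is usually deduced from the extension theorem for completely bounded maps. Here
the dilation space is instead found by one application of the Hahn–Banach theorem, in the form of
M. Riesz. Every linear `V : H → Hb` gives a map `ℂ[X] ⊗ H → Hb`, `p ⊗ h ↦ p(B) V h`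
(`tensorEval B V`), and hence a semi-inner product on `ℂ[X] ⊗ H` on which multiplication by matrices
of polynomials has norm at most `‖[p_ij(B)]‖`. This persists when such semi-inner products are
"integrated" over `V` by a positive functional `ℓ` on functions of `V`. What is needed is an `ℓ` for
which the semi-norm of `1 ⊗ h` is at most `K ‖h‖`, and that of `f` at least the norm of its image
under `φ : p ⊗ h ↦ p(T) h`. It exists (`exists_positive_functional`) because
`∑ ‖tensorEval B V f_s‖² ≤ ∑ ‖V e_t‖²` for all `V` forces `∑ ‖φ f_s‖² ≤ K² ∑ ‖e_t‖²`
(`sum_sq_tensorEval_le`), and this is the hypothesis on `T` read in a basis of `H` extending the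
`e_t`.

The map `φ` intertwines multiplication by `X` with `T`. On the completion of `ℂ[X] ⊗ H` it is bounded
with a bounded right inverse `h ↦ 1 ⊗ h`, so `φ = L Ψ` with `L = (φ φ*)^{1/2}` invertible and `Ψ` a
coisometry. Then `T' = L⁻¹ T L` satisfies `p(T') Ψ = Ψ p(X)`, and is dominated by `B`
(`exists_similar_of_quotient`).
-/

noncomputable section

namespace PolyDom

open scoped TensorProduct

/-! ### Matrices of polynomials -/

section

variable {H : Type*} [NormedAddCommGroup H] [InnerProductSpace ℂ H]

theorem sum_sq_polyMatrix_apply_le {n : ℕ} (p : Fin n → Fin n → ℂ[X]) (T : H →L[ℂ] H)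
    (x : Fin n → H) :
    ∑ i, ‖∑ j, aeval T (p i j) (x j)‖ ^ 2 ≤ ‖polyMatrix p T‖ ^ 2 * ∑ j, ‖x j‖ ^ 2 := by
  have h := (polyMatrix p T).le_opNorm (WithLp.toLp 2 x)
  have h2 := pow_le_pow_left₀ (norm_nonneg _) h 2
  rw [mul_pow, PiLp.norm_sq_eq_of_L2, PiLp.norm_sq_eq_of_L2] at h2
  simpa [polyMatrix, opMatrix_apply] using h2

theorem norm_polyMatrix_le {n : ℕ} (p : Fin n → Fin n → ℂ[X]) (T : H →L[ℂ] H)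
    {c : ℝ} (hc : 0 ≤ c)
    (h : ∀ x : Fin n → H, ∑ i, ‖∑ j, aeval T (p i j) (x j)‖ ^ 2 ≤ c ^ 2 * ∑ j, ‖x j‖ ^ 2) :
    ‖polyMatrix p T‖ ≤ c := by
  refine ContinuousLinearMap.opNorm_le_bound _ hc fun x => ?_
  refine le_of_sq_le_sq ?_ (by positivity)
  rw [mul_pow, PiLp.norm_sq_eq_of_L2, PiLp.norm_sq_eq_of_L2]
  simpa [polyMatrix, opMatrix_apply] using h x.ofLp

/-- The `σ × ι` matrix `p`, filled up with zeros to a square matrix indexed by `σ ⊕ ι`. -/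
def padMatrix {σ ι : Type*} (p : σ → ι → ℂ[X]) : σ ⊕ ι → σ ⊕ ι → ℂ[X]
  | Sum.inl s, Sum.inr t => p s t
  | _, _ => 0

theorem sum_sq_padMatrix {σ ι : Type*} [Fintype σ] [Fintype ι] (p : σ → ι → ℂ[X]) {N : ℕ}
    (e : σ ⊕ ι ≃ Fin N) (A : H →L[ℂ] H) (y : Fin N → H) :
    ∑ i, ‖∑ j, aeval A (padMatrix p (e.symm i) (e.symm j)) (y j)‖ ^ 2 =
      ∑ s, ‖∑ t, aeval A (p s t) (y (e (Sum.inr t)))‖ ^ 2 := by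
  rw [← e.sum_comp]
  have : ∀ a, ∑ j, aeval A (padMatrix p a (e.symm j)) (y j) =
      ∑ b, aeval A (padMatrix p a b) (y (e b)) := by
    intro a
    rw [← e.sum_comp]
    simp
  simp only [Equiv.symm_apply_apply, this]
  simp [Fintype.sum_sum_type, padMatrix]

/-- Domination of square matrices passes to rectangular matrices over arbitrary finite index
types, by filling up with zeros. -/
theorem sum_sq_le_of_dominated {Hb : Type*} [NormedAddCommGroup Hb] [InnerProductSpace ℂ Hb]
    {T : H →L[ℂ] H} {B : Hb →L[ℂ] Hb} {K : ℝ}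
    (hT : DominatedOnWithBound Set.univ K T B)
    {σ ι : Type*} [Fintype σ] [Fintype ι] (p : σ → ι → ℂ[X])
    (hB : ∀ v : ι → Hb, ∑ s, ‖∑ t, aeval B (p s t) (v t)‖ ^ 2 ≤ ∑ t, ‖v t‖ ^ 2) (x : ι → H) :
    ∑ s, ‖∑ t, aeval T (p s t) (x t)‖ ^ 2 ≤ K ^ 2 * ∑ t, ‖x t‖ ^ 2 := by
  classical
  obtain ⟨N, ⟨e⟩⟩ := Finite.exists_equiv_fin (σ ⊕ ι)
  rcases Nat.eq_zero_or_pos N with rfl | hN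
  · have : IsEmpty (σ ⊕ ι) := e.isEmpty
    have : IsEmpty σ := (isEmpty_sum.1 this).1
    have : IsEmpty ι := (isEmpty_sum.1 ‹IsEmpty (σ ⊕ ι)›).2
    simp
  · set P : Fin N → Fin N → ℂ[X] := fun i j => padMatrix p (e.symm i) (e.symm j) with hP
    have h1 : ‖polyMatrix P B‖ ≤ 1 := by
      refine norm_polyMatrix_le _ _ zero_le_one fun y => ?_
      rw [sum_sq_padMatrix, one_pow, one_mul]
      refine (hB _).trans ?_
      rw [← e.sum_comp, Fintype.sum_sum_type]
      exact le_add_of_nonneg_left (by positivity)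
    have h2 : ‖polyMatrix P T‖ ^ 2 ≤ K ^ 2 := by
      have h3 := hT N hN P (fun _ _ => Set.mem_univ _)
      rw [← sq_abs K]
      refine pow_le_pow_left₀ (ContinuousLinearMap.opNorm_nonneg _) (h3.trans ?_) 2
      calc K * ‖polyMatrix P B‖ ≤ |K| * ‖polyMatrix P B‖ := by gcongr; exact le_abs_self K
        _ ≤ |K| * 1 := by gcongr
        _ = |K| := mul_one _
    have h4 := sum_sq_polyMatrix_apply_le P T (fun i => Sum.elim (fun _ => 0) x (e.symm i))
    rw [sum_sq_padMatrix] at h4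
    have h5 : ∑ j, ‖Sum.elim (fun _ : σ => (0 : H)) x (e.symm j)‖ ^ 2 = ∑ t, ‖x t‖ ^ 2 := by
      rw [← e.sum_comp]
      simp [Fintype.sum_sum_type]
    rw [h5] at h4
    simp only [Equiv.symm_apply_apply, Sum.elim_inr] at h4
    exact h4.trans (by gcongr)

/-- A polynomial relation of `B` is one of every operator dominated by `B`. -/
theorem aeval_eq_zero_of_dominated {Hb : Type*} [NormedAddCommGroup Hb] [InnerProductSpace ℂ Hb]
    {T : H →L[ℂ] H} {B : Hb →L[ℂ] Hb} {K : ℝ}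
    (hT : DominatedOnWithBound Set.univ K T B) {p : ℂ[X]} (hp : aeval B p = 0) :
    aeval T p = 0 := by
  ext x
  have h := norm_polyMatrix_le (n := 1) (fun _ _ => p) B le_rfl (by simp [hp])
  have h1 := hT 1 one_pos (fun _ _ => p) (fun _ _ => Set.mem_univ _)
  rw [le_antisymm h (ContinuousLinearMap.opNorm_nonneg _), mul_zero] at h1
  have h2 := sum_sq_polyMatrix_apply_le (n := 1) (fun _ _ => p) T (fun _ => x)
  rw [le_antisymm h1 (ContinuousLinearMap.opNorm_nonneg _)] at h2
  have h3 : ‖aeval T p x‖ ^ 2 ≤ 0 := by simpa using h2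
  simpa using le_antisymm h3 (by positivity)

end

/-! ### Removing linear dependencies -/

section

variable {H : Type*} [NormedAddCommGroup H] [InnerProductSpace ℂ H]

/-- The Hilbert–Schmidt norm does not depend on the orthonormal basis. -/
theorem sum_sq_norm_orthonormalBasis {E G : Type*} [NormedAddCommGroup E] [InnerProductSpace ℂ E]
    [FiniteDimensional ℂ E] [NormedAddCommGroup G] [InnerProductSpace ℂ G]
    {ι κ : Type*} [Fintype ι] [Fintype κ] (b : OrthonormalBasis ι ℂ E)
    (c : OrthonormalBasis κ ℂ E) (A : E →ₗ[ℂ] G) :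
    ∑ i, ‖A (b i)‖ ^ 2 = ∑ k, ‖A (c k)‖ ^ 2 := by
  have key : ∀ x : E, inner ℂ x ((LinearMap.adjoint A.rangeRestrict ∘ₗ A.rangeRestrict) x) =
      ((‖A x‖ ^ 2 : ℝ) : ℂ) := by
    intro x
    rw [LinearMap.comp_apply, LinearMap.adjoint_inner_right, inner_self_eq_norm_sq_to_K]
    simp
  have h := (LinearMap.trace_eq_sum_inner
    (LinearMap.adjoint A.rangeRestrict ∘ₗ A.rangeRestrict) b).symm.trans
    (LinearMap.trace_eq_sum_inner _ c)
  simp only [key] at h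
  exact_mod_cast h

/-- Linear dependencies can be removed from a finite family `e` without changing the quadratic
form `V ↦ ∑ ‖V e_t‖²`: rotating `e` by an orthonormal eigenbasis of its Gram matrix makes the
vectors pairwise orthogonal, and the zero vectors are then dropped. -/
theorem exists_linearIndependent_sum_sq {Hb : Type*} [NormedAddCommGroup Hb]
    [InnerProductSpace ℂ Hb] {n : ℕ} (e : Fin n → H) :
    ∃ (s : Finset (Fin n)) (e' : s → H), LinearIndependent ℂ e' ∧
      (∀ V : H →ₗ[ℂ] Hb, ∑ t, ‖V (e t)‖ ^ 2 = ∑ t, ‖V (e' t)‖ ^ 2) ∧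
      ∑ t, ‖e t‖ ^ 2 = ∑ t, ‖e' t‖ ^ 2 := by
  classical
  let J : EuclideanSpace ℂ (Fin n) →ₗ[ℂ] H :=
    Fintype.linearCombination ℂ e ∘ₗ (WithLp.linearEquiv 2 ℂ (Fin n → ℂ)).toLinearMap
  have hJ : ∀ t, J (EuclideanSpace.basisFun (Fin n) ℂ t) = e t := by
    intro t
    simp [J, Fintype.linearCombination_apply, Pi.single_apply]
  -- `J` is restricted to its finite-dimensional range for the adjoint to be available.
  have hsym : (LinearMap.adjoint J.rangeRestrict ∘ₗ J.rangeRestrict).IsSymmetric :=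
    fun x y => by
      rw [LinearMap.comp_apply, LinearMap.comp_apply, LinearMap.adjoint_inner_left,
        LinearMap.adjoint_inner_right]
  let b := hsym.eigenvectorBasis (n := n) (by simp)
  have horth : ∀ i j, i ≠ j → inner ℂ (J (b i)) (J (b j)) = 0 := by
    intro i j hij
    have h1 : inner ℂ (J (b i)) (J (b j)) =
        inner ℂ (b i) ((LinearMap.adjoint J.rangeRestrict ∘ₗ J.rangeRestrict) (b j)) := by
      rw [LinearMap.comp_apply (LinearMap.adjoint J.rangeRestrict),
        LinearMap.adjoint_inner_right]
      rfl
    rw [h1, hsym.apply_eigenvectorBasis, inner_smul_right, b.inner_eq_zero hij, mul_zero]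
  let s : Finset (Fin n) := {i | J (b i) ≠ 0}
  have hdrop : ∀ g : H → ℝ, g 0 = 0 → ∑ i, g (J (b i)) = ∑ i : s, g (J (b i)) := by
    intro g hg
    rw [Finset.sum_coe_sort s fun i => g (J (b i))]
    refine (Finset.sum_subset (Finset.subset_univ _) fun i _ hi => ?_).symm
    have : J (b i) = 0 := by simpa only [s, Finset.mem_filter_univ, not_not] using hi
    rw [this, hg]
  refine ⟨s, fun i => J (b i), ?_, fun V => ?_, ?_⟩
  · refine linearIndependent_of_ne_zero_of_inner_eq_zero (𝕜 := ℂ) (fun i => ?_) fun i j hij => ?_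
    · exact (Finset.mem_filter.1 (show (i : Fin n) ∈ s from i.2)).2
    · exact horth _ _ fun h => hij (Subtype.ext h)
  · have h := sum_sq_norm_orthonormalBasis (EuclideanSpace.basisFun (Fin n) ℂ) b (V ∘ₗ J)
    simp only [LinearMap.comp_apply V J, hJ] at h
    rw [h, ← hdrop fun x => ‖V x‖ ^ 2]
    simp
  · have h := sum_sq_norm_orthonormalBasis (EuclideanSpace.basisFun (Fin n) ℂ) b J
    simp only [hJ] at h
    rw [h, ← hdrop fun x => ‖x‖ ^ 2]
    simp

/-- A linearly independent family is the first part of a basis. -/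
theorem exists_basis_sum_extend {ι : Type*} {e : ι → H} (he : LinearIndependent ℂ e) :
    ∃ (κ : Set H) (b : Module.Basis (ι ⊕ κ) ℂ H), ∀ i, b (Sum.inl i) = e i := by
  classical
  refine ⟨_, Module.Basis.sumExtend he, fun i => ?_⟩
  simp only [Module.Basis.sumExtend, Module.Basis.coe_reindex, Function.comp_apply,
    Module.Basis.extend_apply_self]
  rfl

end

/-! ### Evaluation of tensors and the key inequality -/

section Eval

variable {H Hb : Type*} [NormedAddCommGroup H] [InnerProductSpace ℂ H]
  [NormedAddCommGroup Hb] [InnerProductSpace ℂ Hb]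

/-- The map `ℂ[X] ⊗ H → Hb`, `p ⊗ h ↦ p(B) V h`. -/
def tensorEval (B : Hb →L[ℂ] Hb) (V : H →ₗ[ℂ] Hb) : ℂ[X] ⊗[ℂ] H →ₗ[ℂ] Hb :=
  TensorProduct.lift
    (LinearMap.lcomp ℂ Hb V ∘ₗ ContinuousLinearMap.coeLM ℂ ∘ₗ (aeval B).toLinearMap)

@[simp]
theorem tensorEval_tmul (B : Hb →L[ℂ] Hb) (V : H →ₗ[ℂ] Hb) (p : ℂ[X]) (h : H) :
    tensorEval B V (p ⊗ₜ h) = aeval B p (V h) := rfl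

theorem tensorEval_smul (B : Hb →L[ℂ] Hb) (V : H →ₗ[ℂ] Hb) (p : ℂ[X]) (f : ℂ[X] ⊗[ℂ] H) :
    tensorEval B V (p • f) = aeval B p (tensorEval B V f) := by
  induction f with
  | zero => simp
  | tmul q h => simp [TensorProduct.smul_tmul']
  | add f g hf hg => simp [hf, hg]

theorem finsupp_sum_eq_sum_inl {ι κ M N : Type*} [Fintype ι] [Zero M] [AddCommMonoid N]
    (c : ι ⊕ κ →₀ M) (g : ι ⊕ κ → M → N) (h0 : ∀ i, g i 0 = 0)
    (hg : ∀ k, g (Sum.inr k) (c (Sum.inr k)) = 0) :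
    c.sum g = ∑ t, g (Sum.inl t) (c (Sum.inl t)) := by
  classical
  rw [Finsupp.sum_of_support_subset c
    (s := c.support ∪ Finset.univ.image Sum.inl) Finset.subset_union_left g fun i _ => h0 i,
    ← Finset.sum_subset (s₁ := Finset.univ.image Sum.inl) Finset.subset_union_right,
    Finset.sum_image Sum.inl_injective.injOn]
  rintro (i | k) _ hi
  · simp at hi
  · exact hg k

/-- The inequality behind the Hahn–Banach argument. In a basis of `H` that starts with the
(linearly independent) vectors `e_t`, the tensors `f_s` become rows of polynomials, and the
hypothesis says that the columns outside of `e` vanish at `B` while those of `e` form a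
contraction `[a_st(B)]`. Domination then bounds `[a_st(T)]`. -/
theorem sum_sq_tensorEval_le {T : H →L[ℂ] H} {B : Hb →L[ℂ] Hb} {K : ℝ}
    (hT : DominatedOnWithBound Set.univ K T B) {m n : ℕ} (f : Fin m → ℂ[X] ⊗[ℂ] H)
    (e : Fin n → H)
    (h : ∀ V : H →ₗ[ℂ] Hb, ∑ s, ‖tensorEval B V (f s)‖ ^ 2 ≤ ∑ t, ‖V (e t)‖ ^ 2) :
    ∑ s, ‖tensorEval T LinearMap.id (f s)‖ ^ 2 ≤ K ^ 2 * ∑ t, ‖e t‖ ^ 2 := by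
  classical
  obtain ⟨S, e', he', hV, hn⟩ := exists_linearIndependent_sum_sq (Hb := Hb) e
  simp only [hV] at h
  rw [hn]
  obtain ⟨κ, b, hb⟩ := exists_basis_sum_extend he'
  choose a ha using fun s => TensorProduct.eq_repr_basis_right b (f s)
  have hev : ∀ (w : S ⊕ κ → Hb) (s),
      tensorEval B (b.constr ℂ w) (f s) = (a s).sum fun i p => aeval B p (w i) := by
    intro w s
    rw [← ha, map_finsuppSum]
    simp
  -- Tested on the `V` that vanish on all basis vectors but one outside of `e'`, where the right-hand
  -- side is zero, the hypothesis gives the polynomial relations `a s (Sum.inr k)` of `B`.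
  have hz : ∀ s k, aeval B (a s (Sum.inr k)) = 0 := by
    intro s k
    ext y
    have h1 := h (b.constr ℂ (Pi.single (Sum.inr k) y))
    simp only [← hb, Module.Basis.constr_basis, hev] at h1
    have h2 : ‖(a s).sum fun i p => aeval B p ((Pi.single (Sum.inr k) y : S ⊕ κ → Hb) i)‖ ^ 2
        ≤ 0 := by
      refine (Finset.single_le_sum (f := fun s => ‖(a s).sum fun i p =>
        aeval B p ((Pi.single (Sum.inr k) y : S ⊕ κ → Hb) i)‖ ^ 2)
        (fun _ _ => by positivity) (Finset.mem_univ s)).trans (h1.trans ?_)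
      simp
    rw [Finsupp.sum_eq_single (Sum.inr k) (fun i _ hi => by simp [Pi.single_eq_of_ne hi])
      (by simp), Pi.single_eq_same] at h2
    simpa using le_antisymm h2 (by positivity)
  -- Tested on the `V` with prescribed values on `e'` and zero elsewhere, it says that `[a_st(B)]` is
  -- a contraction.
  have hc := sum_sq_le_of_dominated hT (fun s t => a s (Sum.inl t)) (fun v => by
    have h1 := h (b.constr ℂ (Sum.elim v 0))
    simp only [← hb, Module.Basis.constr_basis, hev, Sum.elim_inl] at h1
    refine le_of_eq_of_le (Finset.sum_congr rfl fun s _ => ?_) h1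
    rw [finsupp_sum_eq_sum_inl _ _ (by simp) (by simp)]
    simp) e'
  refine le_of_eq_of_le (Finset.sum_congr rfl fun s _ => ?_) hc
  rw [← ha, map_finsuppSum]
  simp only [tensorEval_tmul, LinearMap.id_apply]
  rw [finsupp_sum_eq_sum_inl _ _ (by simp)
    (fun k => by simp [aeval_eq_zero_of_dominated hT (hz s k)])]
  simp [hb]

end Eval

/-! ### The positive functional -/

section Functional

variable {H Hb : Type*} [NormedAddCommGroup H] [InnerProductSpace ℂ H]
  [NormedAddCommGroup Hb] [InnerProductSpace ℂ Hb]

theorem sq_norm_sqrt_smul {E : Type*} [SeminormedAddCommGroup E] [NormedSpace ℂ E] {c : ℝ}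
    (hc : 0 ≤ c) (x : E) : ‖((Real.sqrt c : ℝ) : ℂ) • x‖ ^ 2 = c * ‖x‖ ^ 2 := by
  rw [norm_smul, mul_pow, Complex.norm_real, Real.norm_eq_abs, sq_abs, Real.sq_sqrt hc]

variable (H Hb) in
/-- The functions of a linear map `V : H → Hb` that are bounded by a finite sum
`∑ ‖V e_t‖²`. -/
def quadraticallyBounded : Submodule ℝ ((H →ₗ[ℂ] Hb) → ℝ) where
  carrier := {g | ∃ (n : ℕ) (e : Fin n → H), ∀ V, |g V| ≤ ∑ t, ‖V (e t)‖ ^ 2}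
  zero_mem' := ⟨0, Fin.elim0, by simp⟩
  add_mem' := by
    rintro g g' ⟨n, e, he⟩ ⟨n', e', he'⟩
    refine ⟨n + n', Fin.append e e', fun V => ?_⟩
    simp only [Fin.sum_univ_add, Fin.append_left, Fin.append_right]
    exact (abs_add_le _ _).trans (add_le_add (he V) (he' V))
  smul_mem' := by
    rintro c g ⟨n, e, he⟩
    refine ⟨n, fun t => ((Real.sqrt |c| : ℝ) : ℂ) • e t, fun V => ?_⟩
    simp only [map_smul, sq_norm_sqrt_smul (abs_nonneg c), ← Finset.mul_sum]
    simpa [abs_mul] using mul_le_mul_of_nonneg_left (he V) (abs_nonneg c)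

theorem mem_quadraticallyBounded_of_abs_le {g g' : (H →ₗ[ℂ] Hb) → ℝ}
    (hg' : g' ∈ quadraticallyBounded H Hb) (h : ∀ V, |g V| ≤ g' V) :
    g ∈ quadraticallyBounded H Hb := by
  obtain ⟨n, e, he⟩ := hg'
  exact ⟨n, e, fun V => (h V).trans ((le_abs_self _).trans (he V))⟩

theorem sq_norm_apply_mem (e : H) :
    (fun V : H →ₗ[ℂ] Hb => ‖V e‖ ^ 2) ∈ quadraticallyBounded H Hb :=
  ⟨1, fun _ => e, fun V => by simp⟩

theorem sq_norm_tensorEval_mem (B : Hb →L[ℂ] Hb) (f : ℂ[X] ⊗[ℂ] H) :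
    (fun V => ‖tensorEval B V f‖ ^ 2) ∈ quadraticallyBounded H Hb := by
  induction f with
  | zero => exact mem_quadraticallyBounded_of_abs_le (Submodule.zero_mem _) (by simp)
  | tmul p h =>
    refine mem_quadraticallyBounded_of_abs_le
      (Submodule.smul_mem _ (‖aeval B p‖ ^ 2) (sq_norm_apply_mem h)) fun V => ?_
    rw [abs_of_nonneg (by positivity), Pi.smul_apply, smul_eq_mul, ← mul_pow]
    exact pow_le_pow_left₀ (norm_nonneg _) ((aeval B p).le_opNorm _) 2
  | add f g hf hg =>
    refine mem_quadraticallyBounded_of_abs_le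
      (Submodule.smul_mem _ (2 : ℝ) (Submodule.add_mem _ hf hg)) fun V => ?_
    rw [abs_of_nonneg (by positivity), Pi.smul_apply, Pi.add_apply, smul_eq_mul, map_add]
    exact (pow_le_pow_left₀ (norm_nonneg _) (norm_add_le _ _) 2).trans (add_sq_le)

/-- The cone to which the Riesz extension theorem is applied. A linear functional
`(g, c) ↦ ℓ g + c` is nonnegative on it exactly when `ℓ` is positive, `ℓ(‖V e‖²) ≤ K² ‖e‖²`, and
`ℓ` of the square norm of `tensorEval B V f` is at least that of `tensorEval T id f`. -/
def extensionCone (T : H →L[ℂ] H) (B : Hb →L[ℂ] Hb) (K : ℝ) :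
    PointedCone ℝ (quadraticallyBounded H Hb × ℝ) where
  carrier := {x | ∃ (m n : ℕ) (f : Fin m → ℂ[X] ⊗[ℂ] H) (e : Fin n → H),
    (∀ V, ∑ s, ‖tensorEval B V (f s)‖ ^ 2 ≤ ∑ t, ‖V (e t)‖ ^ 2 + x.1.1 V) ∧
    K ^ 2 * ∑ t, ‖e t‖ ^ 2 - ∑ s, ‖tensorEval T LinearMap.id (f s)‖ ^ 2 ≤ x.2}
  zero_mem' := ⟨0, 0, Fin.elim0, Fin.elim0, by simp, by simp⟩
  add_mem' := by
    rintro x x' ⟨m, n, f, e, h1, h2⟩ ⟨m', n', f', e', h1', h2'⟩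
    refine ⟨m + m', n + n', Fin.append f f', Fin.append e e', fun V => ?_, ?_⟩
    · simp only [Fin.sum_univ_add, Fin.append_left, Fin.append_right]
      have := add_le_add (h1 V) (h1' V)
      simp only [Prod.fst_add, Submodule.coe_add, Pi.add_apply]
      linarith
    · simp only [Fin.sum_univ_add, Fin.append_left, Fin.append_right, Prod.snd_add]
      linarith
  smul_mem' := by
    rintro ⟨c, hc⟩ x ⟨m, n, f, e, h1, h2⟩
    refine ⟨m, n, fun s => ((Real.sqrt c : ℝ) : ℂ) • f s,
      fun t => ((Real.sqrt c : ℝ) : ℂ) • e t, fun V => ?_, ?_⟩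
    · simp only [map_smul, sq_norm_sqrt_smul hc, ← Finset.mul_sum]
      have := mul_le_mul_of_nonneg_left (h1 V) hc
      rw [mul_add] at this
      exact this
    · simp only [map_smul, sq_norm_sqrt_smul hc, ← Finset.mul_sum]
      have := mul_le_mul_of_nonneg_left h2 hc
      have h3 : ((⟨c, hc⟩ : NNReal) • x).2 = c * x.2 := rfl
      refine le_of_eq_of_le (by ring) (this.trans h3.ge)

/-- The functional `ℓ` plays the part of integration over linear maps `V : H → Hb`. It is defined
on all functions for convenience, and is positive only on the quadratically bounded ones. -/
theorem exists_positive_functional {T : H →L[ℂ] H} {B : Hb →L[ℂ] Hb} {K : ℝ}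
    (hT : DominatedOnWithBound Set.univ K T B) :
    ∃ ℓ : ((H →ₗ[ℂ] Hb) → ℝ) →ₗ[ℝ] ℝ,
      (∀ g ∈ quadraticallyBounded H Hb, (∀ V, 0 ≤ g V) → 0 ≤ ℓ g) ∧
      (∀ e, ℓ (fun V => ‖V e‖ ^ 2) ≤ K ^ 2 * ‖e‖ ^ 2) ∧
      ∀ f, ‖tensorEval T LinearMap.id f‖ ^ 2 ≤ ℓ fun V => ‖tensorEval B V f‖ ^ 2 := by
  -- The functional `(0, c) ↦ c` on `0 × ℝ` is nonnegative on the cone by `sum_sq_tensorEval_le`.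
  obtain ⟨G, hG1, hG2⟩ := riesz_extension (extensionCone T B K)
    ⟨LinearMap.range (LinearMap.inr ℝ (quadraticallyBounded H Hb) ℝ),
      (LinearMap.snd ℝ _ ℝ).domRestrict _⟩
    (by
      rintro ⟨x, y, rfl⟩ ⟨m, n, f, e, h1, h2⟩
      have := sum_sq_tensorEval_le hT f e (fun V => by simpa using h1 V)
      simp only [LinearMap.inr_apply] at h2
      change 0 ≤ y
      linarith)
    (by
      rintro ⟨g, c⟩
      obtain ⟨n, e, he⟩ := g.2
      refine ⟨⟨_, K ^ 2 * ∑ t, ‖e t‖ ^ 2 - c, rfl⟩, 0, n, Fin.elim0, e, fun V => ?_, ?_⟩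
      · have := neg_le_of_abs_le (he V)
        simp only [LinearMap.inr_apply, Prod.mk_add_mk, zero_add, Finset.univ_eq_empty,
          Finset.sum_empty]
        linarith
      · simp)
  -- Outside of `quadraticallyBounded H Hb` the values of `ℓ` are arbitrary.
  obtain ⟨ℓ, hℓ⟩ := LinearMap.exists_extend (G ∘ₗ LinearMap.inl ℝ _ ℝ)
  have hℓ' : ∀ g : quadraticallyBounded H Hb, ℓ g = G (g, 0) := fun g => LinearMap.congr_fun hℓ g
  have hsplit : ∀ (g : quadraticallyBounded H Hb) (c : ℝ), G (g, c) = ℓ g + c := by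
    intro g c
    have h1 : G (0, c) = c := hG1 ⟨_, c, rfl⟩
    rw [hℓ', ← h1, ← map_add]
    simp [h1]
  refine ⟨ℓ, fun g hg h => ?_, fun e => ?_, fun f => ?_⟩
  · have := hG2 (⟨g, hg⟩, 0) ⟨0, 0, Fin.elim0, Fin.elim0, by simpa using h, by simp⟩
    rwa [hsplit, add_zero] at this
  · have := hG2 (-⟨_, sq_norm_apply_mem e⟩, K ^ 2 * ‖e‖ ^ 2)
      ⟨0, 1, Fin.elim0, fun _ => e, by simp, by simp⟩
    rw [hsplit, Submodule.coe_neg, map_neg] at this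
    linarith
  · have := hG2 (⟨_, sq_norm_tensorEval_mem B f⟩, -‖tensorEval T LinearMap.id f‖ ^ 2)
      ⟨1, 0, fun _ => f, Fin.elim0, by simp, by simp⟩
    rw [hsplit] at this
    linarith

end Functional

/-! ### From a quotient to a similarity -/

section Similarity

variable {H : Type*} [NormedAddCommGroup H] [InnerProductSpace ℂ H] [CompleteSpace H]

open ContinuousLinearMap in
/-- A bounded map `Φ` onto `H` from a Hilbert space, with a bounded right inverse, is an
invertible operator on `H` times a coisometry. -/
theorem exists_unit_comp_coisometry {E : Type*} [NormedAddCommGroup E] [InnerProductSpace ℂ E]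
    [CompleteSpace E] (Φ : E →L[ℂ] H) (J : H →L[ℂ] E) (h : Φ ∘L J = 1) :
    ∃ (L : (H →L[ℂ] H)ˣ) (Ψ : E →L[ℂ] H), Φ = (L : H →L[ℂ] H) ∘L Ψ ∧ Ψ ∘L adjoint Ψ = 1 := by
  have hpos : 0 ≤ Φ ∘L adjoint Φ :=
    (nonneg_iff_isPositive _).2 (isPositive_self_comp_adjoint Φ)
  have hc : 0 < ‖J‖₊ ^ 2 + 1 := by positivity
  -- `‖x‖² = ⟪J x, Φ* x⟫` bounds `Φ*` from below; the constant is enlarged by `1` so that it is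
  -- positive also when `J = 0`.
  have hunit : IsUnit (Φ ∘L adjoint Φ) := by
    refine isUnit_of_forall_le_norm_inner_map _ (inv_pos.2 hc) fun x => ?_
    have h1 : inner ℂ ((Φ ∘L adjoint Φ) x) x = ((‖adjoint Φ x‖ ^ 2 : ℝ) : ℂ) := by
      rw [comp_apply, ← adjoint_inner_right, inner_self_eq_norm_sq_to_K]
      simp
    have h2 : ‖x‖ ≤ ‖J‖ * ‖adjoint Φ x‖ := by
      have h3 : ‖x‖ * ‖x‖ ≤ ‖J‖ * ‖adjoint Φ x‖ * ‖x‖ := by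
        calc ‖x‖ * ‖x‖ = ‖inner ℂ ((Φ ∘L J) x) x‖ := by rw [h]; simp [inner_self_eq_norm_sq_to_K, sq]
          _ = ‖inner ℂ (J x) (adjoint Φ x)‖ := by rw [comp_apply, adjoint_inner_right]
          _ ≤ ‖J x‖ * ‖adjoint Φ x‖ := norm_inner_le_norm _ _
          _ ≤ ‖J‖ * ‖x‖ * ‖adjoint Φ x‖ := by gcongr; exact J.le_opNorm x
          _ = _ := by ring
      rcases (norm_nonneg x).eq_or_lt with h0 | h0
      · rw [← h0]; positivity
      · exact le_of_mul_le_mul_right h3 h0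
    rw [h1, Complex.norm_real, Real.norm_eq_abs, abs_of_nonneg (by positivity)]
    push_cast
    rw [← div_eq_mul_inv, div_le_iff₀ (by positivity)]
    have := pow_le_pow_left₀ (norm_nonneg _) h2 2
    nlinarith [sq_nonneg ‖adjoint Φ x‖]
  obtain ⟨L, hL⟩ := (CFC.isUnit_sqrt_iff (Φ ∘L adjoint Φ)).2 hunit
  have hLL : (L : H →L[ℂ] H) * L = Φ ∘L adjoint Φ := by
    rw [hL, CFC.sqrt_mul_sqrt_self _ hpos]
  have hsa : star (L : H →L[ℂ] H) = L := by
    rw [hL]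
    exact (CFC.sqrt_nonneg _).isSelfAdjoint
  have hsa' : star (↑L⁻¹ : H →L[ℂ] H) = ↑L⁻¹ := by
    rw [← Units.coe_star_inv]
    congr 2
    exact Units.ext hsa
  refine ⟨L, (↑L⁻¹ : H →L[ℂ] H) ∘L Φ, ?_, ?_⟩
  · rw [← ContinuousLinearMap.comp_assoc]
    change _ = ((L : H →L[ℂ] H) * (↑L⁻¹ : H →L[ℂ] H)) ∘L Φ
    rw [L.mul_inv]
    rfl
  · rw [adjoint_comp, ← star_eq_adjoint, hsa']
    change (↑L⁻¹ : H →L[ℂ] H) * ((Φ ∘L adjoint Φ) * ↑L⁻¹) = 1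
    rw [← hLL, mul_assoc, L.mul_inv, mul_one, L.inv_mul]

open ContinuousLinearMap UniformSpace in
/-- If `T` is a quotient of the operator `A` on the pre-Hilbert space `W`, and `A` is dominated
by `B`, then `T` is similar to an operator dominated by `B`. Neither `A` nor its extension to the
completion of `W` enters the similarity: after the coisometry `Ψ` is extracted from the quotient
map, `p(T') Ψ = Ψ p(A)` on `W` suffices. -/
theorem exists_similar_of_quotient {Hb : Type*} [NormedAddCommGroup Hb] [InnerProductSpace ℂ Hb]
    {W : Type*} [SeminormedAddCommGroup W] [InnerProductSpace ℂ W] {T : H →L[ℂ] H}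
    {B : Hb →L[ℂ] Hb} (A : W →ₗ[ℂ] W) (Φ : W →ₗ[ℂ] H) (J : H →ₗ[ℂ] W) {K : ℝ}
    (hΦ : ∀ f, ‖Φ f‖ ≤ ‖f‖) (hJ : ∀ h, ‖J h‖ ≤ K * ‖h‖) (hΦJ : ∀ h, Φ (J h) = h)
    (hA : ∀ f, Φ (A f) = T (Φ f))
    (hdom : ∀ (n : ℕ) (p : Fin n → Fin n → ℂ[X]) (f : Fin n → W),
      ∑ i, ‖∑ j, aeval A (p i j) (f j)‖ ^ 2 ≤ ‖polyMatrix p B‖ ^ 2 * ∑ j, ‖f j‖ ^ 2) :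
    ∃ T' : H →L[ℂ] H, Similar T T' ∧ CompletelyPolynomiallyDominated T' B := by
  let ι : W →L[ℂ] Completion W := Completion.toComplL
  have hι : DenseRange ι := Completion.denseRange_coe
  have hιn : ∀ f, ‖ι f‖ = ‖f‖ := fun f => Completion.norm_coe f
  let Φ' : W →L[ℂ] H := Φ.mkContinuous 1 (by simpa using hΦ)
  let Φc : Completion W →L[ℂ] H := Φ'.extend ι
  have hΦc : ∀ f, Φc (ι f) = Φ f :=
    fun f => Φ'.extend_eq hι (Completion.isUniformInducing_coe W) f
  let J' : H →L[ℂ] Completion W := ι ∘L J.mkContinuous K hJ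
  obtain ⟨L, Ψ, hLΨ, hΨ⟩ := exists_unit_comp_coisometry Φc J' (by
    ext h
    exact (hΦc _).trans (hΦJ h))
  let T' : H →L[ℂ] H := (↑L⁻¹ : H →L[ℂ] H) * T * (↑L : H →L[ℂ] H)
  have hΨι : ∀ f, (L : H →L[ℂ] H) (Ψ (ι f)) = Φ f := fun f => by
    rw [← hΦc, hLΨ]; rfl
  have hLinv : ∀ x, (↑L⁻¹ : H →L[ℂ] H) ((L : H →L[ℂ] H) x) = x := fun x =>
    DFunLike.congr_fun L.inv_mul x
  have hT' : ∀ f, T' (Ψ (ι f)) = Ψ (ι (A f)) := fun f => by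
    change (↑L⁻¹ : H →L[ℂ] H) (T ((L : H →L[ℂ] H) (Ψ (ι f)))) = _
    rw [hΨι, ← hA, ← hΨι, hLinv]
  have hpT' : ∀ (p : ℂ[X]) f, aeval T' p (Ψ (ι f)) = Ψ (ι (aeval A p f)) := by
    intro p
    induction p using Polynomial.induction_on' with
    | add p q hp hq => intro f; simp [hp, hq]
    | monomial n a =>
      intro f
      have hpow : (T' ^ n) (Ψ (ι f)) = Ψ (ι ((A ^ n) f)) := by
        induction n with
        | zero => simp
        | succ n ih => rw [pow_succ', pow_succ', mul_apply_eq_comp, ih, hT']; rfl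
      simp [aeval_monomial, hpow]
  have hΨadj : ∀ x, Ψ (adjoint Ψ x) = x := fun x => DFunLike.congr_fun hΨ x
  have hadj : ∀ x, ‖adjoint Ψ x‖ = ‖x‖ := fun x => by
    have : ‖adjoint Ψ x‖ ^ 2 = ‖x‖ ^ 2 := by
      have h1 : ((‖adjoint Ψ x‖ ^ 2 : ℝ) : ℂ) = ((‖x‖ ^ 2 : ℝ) : ℂ) := by
        have h2 := adjoint_inner_right Ψ (adjoint Ψ x) x
        rw [hΨadj, inner_self_eq_norm_sq_to_K, inner_self_eq_norm_sq_to_K] at h2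
        simpa using h2
      exact_mod_cast h1
    exact (pow_left_inj₀ (norm_nonneg _) (norm_nonneg _) two_ne_zero).1 this
  have hΨn : ∀ y, ‖Ψ y‖ ≤ ‖y‖ := by
    have h1 : ‖Ψ‖ ≤ 1 := by
      rw [← LinearIsometryEquiv.norm_map adjoint Ψ]
      exact opNorm_le_bound _ zero_le_one fun x => by rw [hadj, one_mul]
    intro y
    simpa using Ψ.le_of_opNorm_le h1 y
  refine ⟨T', ⟨L, rfl⟩, fun n _ p => ?_⟩
  refine norm_polyMatrix_le _ _ (opNorm_nonneg _) fun x => ?_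
  -- By continuity the estimate need only be checked for `y_j` in the dense subspace `W`.
  have hdense : ∀ y : Fin n → Completion W, ∑ i, ‖∑ j, aeval T' (p i j) (Ψ (y j))‖ ^ 2 ≤
      ‖polyMatrix p B‖ ^ 2 * ∑ j, ‖y j‖ ^ 2 := by
    intro y
    have hd : DenseRange fun (f : Fin n → W) j => ι (f j) := DenseRange.piMap fun _ => hι
    refine hd.induction_on (p := fun y => ∑ i, ‖∑ j, aeval T' (p i j) (Ψ (y j))‖ ^ 2 ≤
      ‖polyMatrix p B‖ ^ 2 * ∑ j, ‖y j‖ ^ 2) y (isClosed_le (by fun_prop) (by fun_prop)) ?_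
    intro f
    simp only [hpT', hιn, ← map_sum]
    refine (Finset.sum_le_sum fun i _ => ?_).trans (hdom n p f)
    exact pow_le_pow_left₀ (norm_nonneg _) ((hΨn _).trans_eq (hιn _)) 2
  simpa only [hΨadj, hadj] using hdense fun j => adjoint Ψ (x j)

end Similarity

/-! ### The Hilbert space of the functional -/

section Gns

/-- The complex-linear extension `u + iv ↦ ℓ u + i ℓ v` of a real functional on real-valued
functions. -/
def complexExtension {ι : Type*} (ℓ : (ι → ℝ) →ₗ[ℝ] ℝ) : (ι → ℂ) →ₗ[ℂ] ℂ where
  toFun h := ⟨ℓ fun i => (h i).re, ℓ fun i => (h i).im⟩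
  map_add' h h' := by
    apply Complex.ext
    · exact map_add ℓ (fun i => (h i).re) (fun i => (h' i).re)
    · exact map_add ℓ (fun i => (h i).im) (fun i => (h' i).im)
  map_smul' c h := by
    have h1 := map_sub ℓ (c.re • fun i => (h i).re) (c.im • fun i => (h i).im)
    have h2 := map_add ℓ (c.re • fun i => (h i).im) (c.im • fun i => (h i).re)
    simp only [map_smul] at h1 h2
    apply Complex.ext
    · exact h1
    · exact h2

theorem complexExtension_conj {ι : Type*} (ℓ : (ι → ℝ) →ₗ[ℝ] ℝ) (h : ι → ℂ) :
    complexExtension ℓ (fun i => starRingEnd ℂ (h i)) = starRingEnd ℂ (complexExtension ℓ h) := by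
  apply Complex.ext
  · rfl
  · exact map_neg ℓ fun i => (h i).im

variable {H Hb : Type*} [NormedAddCommGroup H] [InnerProductSpace ℂ H]
  [NormedAddCommGroup Hb] [InnerProductSpace ℂ Hb]

/-- The semi-inner product on `ℂ[X] ⊗ H` obtained by applying `ℓ` to the function
`V ↦ ⟨tensorEval B V f, tensorEval B V g⟩`. -/
@[reducible]
def functionalCore (B : Hb →L[ℂ] Hb) (ℓ : ((H →ₗ[ℂ] Hb) → ℝ) →ₗ[ℝ] ℝ)
    (hℓ : ∀ f, 0 ≤ ℓ fun V => ‖tensorEval B V f‖ ^ 2) :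
    PreInnerProductSpace.Core ℂ (ℂ[X] ⊗[ℂ] H) where
  inner f g := complexExtension ℓ fun V => inner ℂ (tensorEval B V f) (tensorEval B V g)
  conj_inner_symm f g := by
    rw [← complexExtension_conj]
    simp only [inner_conj_symm]
  re_inner_nonneg f := by
    refine (hℓ f).trans_eq (congrArg ℓ ?_)
    funext V
    exact (inner_self_eq_norm_sq (𝕜 := ℂ) _).symm
  add_left f g k := by
    rw [← map_add]
    congr 1
    funext V
    simp
  smul_left f g c := by
    rw [← smul_eq_mul, ← map_smul]
    congr 1
    funext V
    simp [mul_comm]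

theorem re_functionalCore_inner_self (B : Hb →L[ℂ] Hb) (ℓ : ((H →ₗ[ℂ] Hb) → ℝ) →ₗ[ℝ] ℝ)
    (hℓ : ∀ f, 0 ≤ ℓ fun V => ‖tensorEval B V f‖ ^ 2) (f : ℂ[X] ⊗[ℂ] H) :
    ((functionalCore B ℓ hℓ).inner f f).re = ℓ fun V => ‖tensorEval B V f‖ ^ 2 := by
  refine congrArg ℓ ?_
  funext V
  exact inner_self_eq_norm_sq (𝕜 := ℂ) _

/-- Paulsen's similarity theorem for the algebra of polynomials in one operator. -/
theorem exists_similar_of_dominated [CompleteSpace H] {T : H →L[ℂ] H} {B : Hb →L[ℂ] Hb} {K : ℝ}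
    (hT : DominatedOnWithBound Set.univ K T B) :
    ∃ T' : H →L[ℂ] H, Similar T T' ∧ CompletelyPolynomiallyDominated T' B := by
  obtain ⟨ℓ, hpos, hle, hge⟩ := exists_positive_functional hT
  have hℓ : ∀ f, 0 ≤ ℓ fun V => ‖tensorEval B V f‖ ^ 2 := fun f =>
    (by positivity : (0 : ℝ) ≤ _).trans (hge f)
  let core := functionalCore B ℓ hℓ
  let : SeminormedAddCommGroup (ℂ[X] ⊗[ℂ] H) :=
    InnerProductSpace.Core.toSeminormedAddCommGroup (𝕜 := ℂ)
  let : InnerProductSpace ℂ (ℂ[X] ⊗[ℂ] H) := InnerProductSpace.ofCore core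
  have hnorm : ∀ f : ℂ[X] ⊗[ℂ] H, ‖f‖ ^ 2 = ℓ fun V => ‖tensorEval B V f‖ ^ 2 := fun f => by
    rw [← re_functionalCore_inner_self B ℓ hℓ]
    exact (inner_self_eq_norm_sq (𝕜 := ℂ) f).symm
  have haeval : ∀ (p : ℂ[X]) (f : ℂ[X] ⊗[ℂ] H),
      aeval (Module.toModuleEnd ℂ (S := ℂ[X]) (ℂ[X] ⊗[ℂ] H) X) p f = p • f := by
    intro p f
    induction p using Polynomial.induction_on' with
    | add p q hp hq => rw [map_add, LinearMap.add_apply, hp, hq, add_smul]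
    | monomial n a =>
      rw [aeval_monomial, ← map_pow, ← C_mul_X_pow_eq_monomial, mul_smul, ← Polynomial.algebraMap_eq,
        algebraMap_smul]
      rfl
  refine exists_similar_of_quotient (K := |K|)
    (Module.toModuleEnd ℂ (S := ℂ[X]) (ℂ[X] ⊗[ℂ] H) X)
    (tensorEval T LinearMap.id) (TensorProduct.mk ℂ ℂ[X] H 1) (fun f => ?_) (fun h => ?_)
    (fun h => by simp) (fun f => ?_) (fun n p f => ?_)
  · exact le_of_sq_le_sq ((hge f).trans_eq (hnorm f).symm) (norm_nonneg _)
  · refine le_of_sq_le_sq ?_ (by positivity)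
    rw [hnorm, mul_pow, sq_abs]
    simpa using hle h
  · exact (tensorEval_smul T _ X f).trans (by simp)
  · simp only [haeval, hnorm]
    -- The estimate holds pointwise in `V`, and `ℓ` is positive.
    let Q : ℂ[X] ⊗[ℂ] H → (H →ₗ[ℂ] Hb) → ℝ := fun f V => ‖tensorEval B V f‖ ^ 2
    have h := hpos (‖polyMatrix p B‖ ^ 2 • ∑ j, Q (f j) - ∑ i, Q (∑ j, p i j • f j))
      (Submodule.sub_mem _
        (Submodule.smul_mem _ _ (Submodule.sum_mem _ fun j _ => sq_norm_tensorEval_mem B _))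
        (Submodule.sum_mem _ fun i _ => sq_norm_tensorEval_mem B _))
      (fun V => by
        have h1 := sum_sq_polyMatrix_apply_le p B fun j => tensorEval B V (f j)
        simpa [Q, tensorEval_smul, Finset.sum_apply] using h1)
    rw [map_sub, map_smul, map_sum, map_sum, smul_eq_mul, sub_nonneg] at h
    exact h

end Gns

/-! ### Norms of polynomial matrices and membership in `z^d A(𝔻)` -/

section Reduction

variable {G : Type*} [NormedAddCommGroup G] [InnerProductSpace ℂ G]

theorem norm_polyMatrix_add_le {n : ℕ} (p q : Fin n → Fin n → ℂ[X]) (T : G →L[ℂ] G) :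
    ‖polyMatrix (fun i j => p i j + q i j) T‖ ≤ ‖polyMatrix p T‖ + ‖polyMatrix q T‖ := by
  have h : polyMatrix (fun i j => p i j + q i j) T = polyMatrix p T + polyMatrix q T := by
    ext x i
    simp [polyMatrix, opMatrix_apply, Finset.sum_add_distrib]
  rw [h]
  exact ContinuousLinearMap.opNorm_add_le _ _

theorem norm_polyMatrix_sub_le {n : ℕ} (p q : Fin n → Fin n → ℂ[X]) (T : G →L[ℂ] G) :
    ‖polyMatrix (fun i j => p i j - q i j) T‖ ≤ ‖polyMatrix p T‖ + ‖polyMatrix q T‖ := by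
  have h : polyMatrix (fun i j => p i j - q i j) T = polyMatrix p T + -polyMatrix q T := by
    ext x i
    simp [polyMatrix, opMatrix_apply, sub_eq_add_neg, Finset.sum_add_distrib]
  rw [h, ← ContinuousLinearMap.opNorm_neg (polyMatrix q T)]
  exact ContinuousLinearMap.opNorm_add_le _ _

theorem norm_polyMatrix_sum_le {n : ℕ} {κ : Type*} (s : Finset κ)
    (p : κ → Fin n → Fin n → ℂ[X]) (T : G →L[ℂ] G) :
    ‖polyMatrix (fun i j => ∑ k ∈ s, p k i j) T‖ ≤ ∑ k ∈ s, ‖polyMatrix (p k) T‖ := by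
  classical
  induction s using Finset.induction_on with
  | empty => exact norm_polyMatrix_le _ _ (by simp) fun x => by simp
  | insert a s ha ih =>
    simp only [Finset.sum_insert ha]
    exact (norm_polyMatrix_add_le (p a) _ T).trans (by gcongr)

/-- A scalar matrix has the same norm on `ℂⁿ` as on `Gⁿ`. -/
theorem sum_sq_norm_sum_smul_le {n : ℕ} (A : Fin n → Fin n → ℂ) {α : ℝ}
    (hA : ∀ c : Fin n → ℂ, ∑ i, ‖∑ j, A i j * c j‖ ^ 2 ≤ α ^ 2 * ∑ j, ‖c j‖ ^ 2)
    (x : Fin n → G) :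
    ∑ i, ‖∑ j, A i j • x j‖ ^ 2 ≤ α ^ 2 * ∑ j, ‖x j‖ ^ 2 := by
  let E := Submodule.span ℂ (Set.range x)
  let y : Fin n → E := fun j => ⟨x j, Submodule.subset_span ⟨j, rfl⟩⟩
  have : FiniteDimensional ℂ E := FiniteDimensional.span_of_finite ℂ (Set.finite_range x)
  let u := stdOrthonormalBasis ℂ E
  have h1 : ∀ i, ‖∑ j, A i j • x j‖ ^ 2 = ∑ k, ‖∑ j, A i j * inner ℂ (u k) (y j)‖ ^ 2 := by
    intro i
    have : ‖∑ j, A i j • x j‖ = ‖∑ j, A i j • y j‖ := by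
      rw [← Submodule.norm_coe]
      simp [y]
    rw [this, ← u.sum_sq_norm_inner_right]
    simp [inner_sum, inner_smul_right]
  have h2 : ∀ j, ‖x j‖ ^ 2 = ∑ k, ‖inner ℂ (u k) (y j)‖ ^ 2 := fun j =>
    (u.sum_sq_norm_inner_right (y j)).symm
  simp only [h1, h2]
  rw [Finset.sum_comm, Finset.sum_comm (s := Finset.univ (α := Fin n)), Finset.mul_sum]
  exact Finset.sum_le_sum fun k _ => hA fun j => inner ℂ (u k) (y j)

theorem norm_polyMatrix_monomial_le {n : ℕ} (A : Fin n → Fin n → ℂ) {α : ℝ} (hα : 0 ≤ α)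
    (hA : ∀ c : Fin n → ℂ, ∑ i, ‖∑ j, A i j * c j‖ ^ 2 ≤ α ^ 2 * ∑ j, ‖c j‖ ^ 2) (k : ℕ)
    (T : G →L[ℂ] G) :
    ‖polyMatrix (fun i j => monomial k (A i j)) T‖ ≤ α * ‖T ^ k‖ := by
  refine norm_polyMatrix_le _ _ (by positivity) fun x => ?_
  have h := sum_sq_norm_sum_smul_le A hA fun j => (T ^ k) (x j)
  have h1 : ∀ i j, aeval T (monomial k (A i j)) (x j) = A i j • (T ^ k) (x j) := by
    intro i j
    simp [aeval_monomial, Algebra.algebraMap_eq_smul_one]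
  simp only [h1]
  refine h.trans ?_
  rw [mul_pow, mul_assoc, Finset.mul_sum (a := ‖T ^ k‖ ^ 2)]
  gcongr with j
  rw [← mul_pow]
  exact pow_le_pow_left₀ (norm_nonneg _) ((T ^ k).le_opNorm _) 2

theorem mem_zPowPolynomials_of_coeff {d : ℕ} {p : ℂ[X]} (hp : ∀ k < d, p.coeff k = 0) :
    p ∈ zPowPolynomials d := by
  refine ⟨⟨p.continuous.continuousOn, p.differentiable.differentiableOn⟩, fun k hk => ?_⟩
  have h : ∀ k, iteratedDeriv k (fun z : ℂ => p.eval z) = fun z => (derivative^[k] p).eval z := by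
    intro k
    induction k with
    | zero => simp
    | succ k ih =>
      rw [iteratedDeriv_succ, ih, Function.iterate_succ_apply']
      funext z
      exact (derivative^[k] p).deriv
  rw [h]
  simp only
  rw [← coeff_zero_eq_eval_zero, coeff_iterate_derivative, zero_add, hp k hk, smul_zero]

/-! ### The shift and direct sums -/

theorem shift_pow_single_apply (m k : ℕ) (c : ℂ) :
    (shift ^ m) (lp.single 2 0 c) k = if k = m then c else 0 := by
  induction m generalizing k with
  | zero =>
    rw [pow_zero, one_apply_eq_self, lp.single_apply]
    simp [Pi.single_apply]
  | succ m ih =>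
    rw [pow_succ', mul_apply_eq_comp]
    cases k with
    | zero => simp [shift_apply_zero]
    | succ k => rw [shift_apply_succ, ih]; simp

theorem aeval_shift_single_apply (p : ℂ[X]) (k : ℕ) (c : ℂ) :
    aeval shift p (lp.single 2 0 c) k = p.coeff k * c := by
  induction p using Polynomial.induction_on' with
  | add p q hp hq => simp [hp, hq, add_mul]
  | monomial m a =>
    have h : aeval shift (monomial m a) (lp.single 2 0 c) =
        a • (shift ^ m) (lp.single 2 0 c) := by
      simp [aeval_monomial, Algebra.algebraMap_eq_smul_one]
    rw [h, lp.coeFn_smul, Pi.smul_apply, shift_pow_single_apply, coeff_monomial]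
    by_cases hk : k = m
    · simp [hk]
    · simp [hk, Ne.symm hk]

/-- The coefficient matrices of `p` are bounded by `‖p(S)‖`, because the column of `p(S)` at the
first basis vector of `ℓ₂` lists the coefficients. -/
theorem sum_sq_coeff_le {n : ℕ} (p : Fin n → Fin n → ℂ[X]) (k : ℕ) (c : Fin n → ℂ) :
    ∑ i, ‖∑ j, (p i j).coeff k * c j‖ ^ 2 ≤ ‖polyMatrix p shift‖ ^ 2 * ∑ j, ‖c j‖ ^ 2 := by
  have h := sum_sq_polyMatrix_apply_le p shift fun j => lp.single 2 0 (c j)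
  simp only [lp.norm_single (p := 2) (by norm_num)] at h
  refine (Finset.sum_le_sum fun i _ => ?_).trans h
  refine pow_le_pow_left₀ (norm_nonneg _) ?_ 2
  refine le_of_eq_of_le ?_ (lp.norm_apply_le_norm (p := 2) (by norm_num) _ k)
  rw [lp.coeFn_sum, Finset.sum_apply]
  simp only [aeval_shift_single_apply]

theorem aeval_directSum_apply {E F : Type*} [NormedAddCommGroup E] [InnerProductSpace ℂ E]
    [NormedAddCommGroup F] [InnerProductSpace ℂ F] (A : E →L[ℂ] E) (B : F →L[ℂ] F) (p : ℂ[X])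
    (x : E) (y : F) :
    aeval (directSum A B) p (WithLp.toLp 2 (x, y)) =
      WithLp.toLp 2 (aeval A p x, aeval B p y) := by
  induction p using Polynomial.induction_on' with
  | add p q hp hq => simp [hp, hq, ← WithLp.toLp_add]
  | monomial n a =>
    have hpow : ((directSum A B) ^ n) (WithLp.toLp 2 (x, y)) =
        WithLp.toLp 2 ((A ^ n) x, (B ^ n) y) := by
      induction n with
      | zero => simp
      | succ n ih =>
        simp only [pow_succ', mul_apply_eq_comp, ih,
          directSum_apply]
    simp [aeval_monomial, Algebra.algebraMap_eq_smul_one, hpow, ← WithLp.toLp_smul]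

theorem norm_polyMatrix_le_directSum_left {E F : Type*} [NormedAddCommGroup E]
    [InnerProductSpace ℂ E] [NormedAddCommGroup F] [InnerProductSpace ℂ F] {n : ℕ}
    (p : Fin n → Fin n → ℂ[X]) (A : E →L[ℂ] E) (B : F →L[ℂ] F) :
    ‖polyMatrix p A‖ ≤ ‖polyMatrix p (directSum A B)‖ := by
  refine norm_polyMatrix_le _ _ (ContinuousLinearMap.opNorm_nonneg _) fun x => ?_
  have h := sum_sq_polyMatrix_apply_le p (directSum A B) fun j => WithLp.toLp 2 (x j, (0 : F))
  simpa [aeval_directSum_apply, ← WithLp.toLp_sum, WithLp.prod_norm_sq_eq_of_L2, Prod.fst_sum,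
    Prod.snd_sum] using h

theorem norm_polyMatrix_le_directSum_right {E F : Type*} [NormedAddCommGroup E]
    [InnerProductSpace ℂ E] [NormedAddCommGroup F] [InnerProductSpace ℂ F] {n : ℕ}
    (p : Fin n → Fin n → ℂ[X]) (A : E →L[ℂ] E) (B : F →L[ℂ] F) :
    ‖polyMatrix p B‖ ≤ ‖polyMatrix p (directSum A B)‖ := by
  refine norm_polyMatrix_le _ _ (ContinuousLinearMap.opNorm_nonneg _) fun y => ?_
  have h := sum_sq_polyMatrix_apply_le p (directSum A B) fun j => WithLp.toLp 2 ((0 : E), y j)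
  simpa [aeval_directSum_apply, ← WithLp.toLp_sum, WithLp.prod_norm_sq_eq_of_L2, Prod.fst_sum,
    Prod.snd_sum] using h

/-! ### From `z^d A(𝔻)` to all polynomials -/

/-- The Taylor polynomial of degree less than `d`. -/
def lowPart (d : ℕ) (p : ℂ[X]) : ℂ[X] := ∑ k ∈ Finset.range d, monomial k (p.coeff k)

theorem sub_lowPart_mem (d : ℕ) (p : ℂ[X]) : p - lowPart d p ∈ zPowPolynomials d := by
  refine mem_zPowPolynomials_of_coeff fun k hk => ?_
  simp [lowPart, coeff_monomial, hk]

theorem norm_polyMatrix_lowPart_le {n : ℕ} (d : ℕ) (p : Fin n → Fin n → ℂ[X]) (T : G →L[ℂ] G) :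
    ‖polyMatrix (fun i j => lowPart d (p i j)) T‖ ≤
      ‖polyMatrix p shift‖ * ∑ k ∈ Finset.range d, ‖T ^ k‖ := by
  rw [Finset.mul_sum]
  refine (norm_polyMatrix_sum_le _ (fun k i j => monomial k ((p i j).coeff k)) T).trans
    (Finset.sum_le_sum fun k _ => ?_)
  exact norm_polyMatrix_monomial_le _ (ContinuousLinearMap.opNorm_nonneg _)
    (fun c => sum_sq_coeff_le p k c) k T

/-- Adding the shift extends domination from `z^d A(𝔻)` to all polynomials: the first `d`
coefficient matrices of `p` are bounded by `‖p(S)‖`, and what remains lies in `z^d A(𝔻)`. -/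
theorem exists_dominated_directSum_shift {H Hc : Type*} [NormedAddCommGroup H]
    [InnerProductSpace ℂ H] [NormedAddCommGroup Hc] [InnerProductSpace ℂ Hc] {d : ℕ}
    {T : H →L[ℂ] H} {M : ℝ} {C : Hc →L[ℂ] Hc}
    (hT : DominatedOnWithBound (zPowPolynomials d) M T C) :
    ∃ K, DominatedOnWithBound Set.univ K T (directSum C shift) := by
  refine ⟨∑ k ∈ Finset.range d, ‖T ^ k‖ + |M| * (1 + ∑ k ∈ Finset.range d, ‖C ^ k‖),
    fun n hn p _ => ?_⟩
  let r : Fin n → Fin n → ℂ[X] := fun i j => p i j - lowPart d (p i j)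
  have hsplit : p = fun i j => lowPart d (p i j) + r i j := by
    funext i j
    simp [r]
  have hpT := norm_polyMatrix_add_le (fun i j => lowPart d (p i j)) r T
  rw [← hsplit] at hpT
  have hS := norm_polyMatrix_le_directSum_right p C shift
  have hC := norm_polyMatrix_le_directSum_left p C shift
  set γ := ‖polyMatrix p (directSum C shift)‖
  have hrC : ‖polyMatrix r C‖ ≤ γ + γ * ∑ k ∈ Finset.range d, ‖C ^ k‖ := by
    refine (norm_polyMatrix_sub_le p (fun i j => lowPart d (p i j)) C).trans
      (add_le_add hC ?_)
    exact (norm_polyMatrix_lowPart_le d p C).trans (by gcongr)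
  have hrT : ‖polyMatrix r T‖ ≤ |M| * ‖polyMatrix r C‖ :=
    (hT n hn r fun i j => sub_lowPart_mem d (p i j)).trans
      (mul_le_mul_of_nonneg_right (le_abs_self M) (ContinuousLinearMap.opNorm_nonneg _))
  calc ‖polyMatrix p T‖
      ≤ ‖polyMatrix (fun i j => lowPart d (p i j)) T‖ + ‖polyMatrix r T‖ :=
        hpT
    _ ≤ γ * ∑ k ∈ Finset.range d, ‖T ^ k‖ +
          |M| * (γ + γ * ∑ k ∈ Finset.range d, ‖C ^ k‖) := by
        refine add_le_add ((norm_polyMatrix_lowPart_le d p T).trans (by gcongr))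
          (hrT.trans (by gcongr))
    _ = _ := by ring

end Reduction

/-! ### The supremum over the circle -/

section Circle

/-- The vector `(conj w ^ k)_k`, an eigenvector of the adjoint of the shift. -/
def szegoVector (w : ℂ) (hw : ‖w‖ < 1) : ellTwo :=
  ⟨fun k => (starRingEnd ℂ w) ^ k, by
    refine memℓp_gen ?_
    simp only [norm_pow, RCLike.norm_conj, ENNReal.toReal_ofNat, Real.rpow_ofNat]
    simp only [← pow_mul, mul_comm _ 2]
    simp only [pow_mul]
    exact summable_geometric_of_lt_one (by positivity) (by nlinarith [norm_nonneg w])⟩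

theorem szegoVector_ne_zero {w : ℂ} (hw : ‖w‖ < 1) : szegoVector w hw ≠ 0 := by
  intro h
  have h0 : szegoVector w hw 0 = 0 := by rw [h]; rfl
  simp [szegoVector] at h0

theorem inner_szegoVector_shift {w : ℂ} (hw : ‖w‖ < 1) (x : ellTwo) :
    inner ℂ (szegoVector w hw) (shift x) = w * inner ℂ (szegoVector w hw) x := by
  rw [lp.inner_eq_tsum, lp.inner_eq_tsum, ← tsum_mul_left,
    (lp.summable_inner (𝕜 := ℂ) (szegoVector w hw) (shift x)).tsum_eq_zero_add]
  simp only [shift_apply_zero, shift_apply_succ, inner_zero_right, zero_add]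
  congr 1
  funext k
  simp [szegoVector, pow_succ]
  ring

theorem inner_szegoVector_aeval_shift {w : ℂ} (hw : ‖w‖ < 1) (p : ℂ[X]) (x : ellTwo) :
    inner ℂ (szegoVector w hw) (aeval shift p x) =
      p.eval w * inner ℂ (szegoVector w hw) x := by
  induction p using Polynomial.induction_on' with
  | add p q hp hq => simp [hp, hq, add_mul]
  | monomial n a =>
    have hpow : inner ℂ (szegoVector w hw) ((shift ^ n) x) =
        w ^ n * inner ℂ (szegoVector w hw) x := by
      induction n with
      | zero => simp
      | succ n ih =>
        rw [pow_succ', mul_apply_eq_comp, inner_szegoVector_shift, ih, pow_succ', mul_assoc]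
    have h : aeval shift (monomial n a) x = a • (shift ^ n) x := by
      simp [aeval_monomial, Algebra.algebraMap_eq_smul_one]
    rw [h, inner_smul_right, hpow, eval_monomial, mul_assoc]

/-- For `|w| < 1` the matrix `[p_ij(w)]` is bounded by `‖p(S)‖`: pairing `p(S)` applied to multiples
of the Szegő vector at `w` with that vector gives `[p_ij(w)]`. -/
theorem sum_sq_eval_le_of_norm_lt_one {n : ℕ} (p : Fin n → Fin n → ℂ[X]) {w : ℂ} (hw : ‖w‖ < 1)
    (c : Fin n → ℂ) :
    ∑ i, ‖∑ j, (p i j).eval w * c j‖ ^ 2 ≤ ‖polyMatrix p shift‖ ^ 2 * ∑ j, ‖c j‖ ^ 2 := by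
  set k := szegoVector w hw
  have hk : 0 < ‖k‖ ^ 2 := by
    have := norm_pos_iff.2 (szegoVector_ne_zero hw)
    positivity
  have h := sum_sq_polyMatrix_apply_le p shift fun j => c j • k
  have h1 : ∀ i, ‖k‖ ^ 2 * ‖∑ j, (p i j).eval w * c j‖ ^ 2 ≤
      ‖∑ j, aeval shift (p i j) (c j • k)‖ ^ 2 := by
    intro i
    have h2 := norm_inner_le_norm (𝕜 := ℂ) k (∑ j, aeval shift (p i j) (c j • k))
    have h3 : inner ℂ k (∑ j, aeval shift (p i j) (c j • k)) =
        (∑ j, (p i j).eval w * c j) * ((‖k‖ ^ 2 : ℝ) : ℂ) := by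
      rw [inner_sum, Finset.sum_mul]
      refine Finset.sum_congr rfl fun j _ => ?_
      rw [inner_szegoVector_aeval_shift, inner_smul_right, inner_self_eq_norm_sq_to_K, mul_assoc]
      simp [k]
    rw [h3, norm_mul, Complex.norm_real, Real.norm_of_nonneg hk.le] at h2
    have h4 : ‖k‖ * ‖∑ j, (p i j).eval w * c j‖ ≤ ‖∑ j, aeval shift (p i j) (c j • k)‖ := by
      refine le_of_mul_le_mul_left (a := ‖k‖) ?_ (norm_pos_iff.2 (szegoVector_ne_zero hw))
      linarith
    rw [← mul_pow]
    exact pow_le_pow_left₀ (by positivity) h4 2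
  refine le_of_mul_le_mul_left (a := ‖k‖ ^ 2) ?_ hk
  rw [Finset.mul_sum]
  refine ((Finset.sum_le_sum fun i _ => h1 i).trans h).trans_eq ?_
  simp only [norm_smul, mul_pow, ← Finset.sum_mul]
  ring

/-- The maximum over the circle of a polynomial matrix is at most its norm at the shift. -/
theorem circleSup_le {n : ℕ} (p : Fin n → Fin n → ℂ[X]) :
    circleSup p ≤ ‖polyMatrix p shift‖ := by
  refine ciSup_le fun z => ?_
  refine ContinuousLinearMap.opNorm_le_bound _ (ContinuousLinearMap.opNorm_nonneg _) fun c => ?_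
  refine le_of_sq_le_sq ?_ (by positivity)
  rw [mul_pow, EuclideanSpace.norm_sq_eq, EuclideanSpace.norm_sq_eq]
  have hcl : (z : ℂ) ∈ closure (Metric.ball (0 : ℂ) 1) := by
    rw [closure_ball _ one_ne_zero]
    exact Metric.sphere_subset_closedBall z.2
  have hclosed : IsClosed {w : ℂ | ∑ i, ‖∑ j, (p i j).eval w * c j‖ ^ 2 ≤
      ‖polyMatrix p shift‖ ^ 2 * ∑ j, ‖c j‖ ^ 2} :=
    isClosed_le (by fun_prop) continuous_const
  have h : ∑ i, ‖∑ j, (p i j).eval (z : ℂ) * c j‖ ^ 2 ≤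
      ‖polyMatrix p shift‖ ^ 2 * ∑ j, ‖c j‖ ^ 2 :=
    closure_minimal (fun w hw => sum_sq_eval_le_of_norm_lt_one p (by simpa using hw) c)
      hclosed hcl
  simpa [Matrix.mulVec, dotProduct] using h

theorem norm_directSum_shift_shift_apply (x : WithLp 2 (ellTwo × ellTwo)) :
    ‖directSum shift shift x‖ = ‖x‖ := by
  have hs : ∀ y, ‖shift y‖ = ‖y‖ := shiftIsometry.norm_map
  refine (pow_left_inj₀ (norm_nonneg _) (norm_nonneg _) two_ne_zero).1 ?_
  rw [WithLp.prod_norm_sq_eq_of_L2, WithLp.prod_norm_sq_eq_of_L2, ← hs x.fst, ← hs x.snd]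
  rfl

theorem norm_le_one_of_dominated {H Hb : Type*} [NormedAddCommGroup H] [InnerProductSpace ℂ H]
    [NormedAddCommGroup Hb] [InnerProductSpace ℂ Hb] {T : H →L[ℂ] H} {B : Hb →L[ℂ] Hb}
    (h : CompletelyPolynomiallyDominated T B) (hB : ∀ x, ‖B x‖ ≤ ‖x‖) : ‖T‖ ≤ 1 := by
  have h1 : ‖polyMatrix (fun _ _ : Fin 1 => X) T‖ ≤ 1 := (h 1 one_pos fun _ _ => X).trans
    (norm_polyMatrix_le _ _ zero_le_one fun x => by
      simpa using pow_le_pow_left₀ (norm_nonneg _) (hB (x 0)) 2)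
  refine ContinuousLinearMap.opNorm_le_bound _ zero_le_one fun x => ?_
  have h2 := sum_sq_polyMatrix_apply_le (fun _ _ : Fin 1 => X) T fun _ => x
  have h3 := pow_le_pow_left₀ (ContinuousLinearMap.opNorm_nonneg _) h1 2
  refine le_of_sq_le_sq ?_ (by positivity)
  simp only [Finset.univ_unique, Finset.sum_singleton, aeval_X] at h2
  refine h2.trans ?_
  rw [mul_pow]
  gcongr

end Circle

end PolyDom

end

theorem mainTheorem10 {H : Type*} [NormedAddCommGroup H] [InnerProductSpace ℂ H] [CompleteSpace H]
    {Hc : Type*} [NormedAddCommGroup Hc] [InnerProductSpace ℂ Hc] [CompleteSpace Hc]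
    (d : ℕ) (hd : 1 ≤ d) (T : H →L[ℂ] H) (M : ℝ) :
    (∀ C : Hc →L[ℂ] Hc,
      PolyDom.DominatedOnWithBound (PolyDom.zPowPolynomials d) M T C →
        ∃ T' : H →L[ℂ] H, PolyDom.Similar T T' ∧
          PolyDom.CompletelyPolynomiallyDominated T' (PolyDom.directSum C PolyDom.shift)) ∧
    ((∀ n : ℕ, 0 < n → ∀ p : Fin n → Fin n → Polynomial ℂ,
        (∀ i j, p i j ∈ PolyDom.zPowPolynomials d) →
          ‖PolyDom.polyMatrix p T‖ ≤ M * PolyDom.circleSup p) →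
      ∃ T' : H →L[ℂ] H, PolyDom.Similar T T' ∧ ‖T'‖ ≤ 1) := by
  refine ⟨fun C hC => ?_, fun hT => ?_⟩
  · obtain ⟨K, hK⟩ := PolyDom.exists_dominated_directSum_shift hC
    exact PolyDom.exists_similar_of_dominated hK
  · have hS : PolyDom.DominatedOnWithBound (PolyDom.zPowPolynomials d) |M| T PolyDom.shift := by
      intro n hn p hp
      have h0 : 0 ≤ PolyDom.circleSup p :=
        Real.iSup_nonneg fun z => ContinuousLinearMap.opNorm_nonneg _
      calc ‖PolyDom.polyMatrix p T‖ ≤ M * PolyDom.circleSup p := hT n hn p hp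
        _ ≤ |M| * PolyDom.circleSup p := by gcongr; exact le_abs_self M
        _ ≤ |M| * ‖PolyDom.polyMatrix p PolyDom.shift‖ := by
            gcongr; exact PolyDom.circleSup_le p
    obtain ⟨K, hK⟩ := PolyDom.exists_dominated_directSum_shift hS
    obtain ⟨T', hsim, hdom⟩ := PolyDom.exists_similar_of_dominated hK
    exact ⟨T', hsim, PolyDom.norm_le_one_of_dominated hdom
      fun x => (PolyDom.norm_directSum_shift_shift_apply x).le⟩
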